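/- Let $\mathbb H$ be the real algebra of quaternions. A quaternionic Hilbert space is a nonzero right $\mathbb H$-module $\mathsf H$ with a scalar product $\langle\cdot|\cdot\rangle:\mathsf H\times\mathsf H\to\mathbb H$ such that $\langle u|vp+wq\rangle=\langle u|v\rangle p+\langle u|w\rangle q$, $\langle u|v\rangle=\overline{\langle v|u\rangle}$, $\langle u|u\rangle\in[0,+\infty)$, with $\langle u|u\rangle=0$ only for $u=0$, which is complete for the norm $\|u\|=\sqrt{\langle u|u\rangle}$. Let $\mathfrak B(\mathsf H)$ be the real algebra of bounded right $\mathbb H$-linear operators $\mathsf H\to\mathsf H$, with the operator norm and $(Tr)(u):=T(u)r$ for $r\in\mathbb R$; the adjoint $T^*\in\mathfrak B(\mathsf H)$ is given by $\langle T^*u|v\rangle=\langle u|Tv\rangle$, and $T$ is self-adjoint if $T=T^*$ and normal if $TT^*=T^*T$. For $T\in\mathfrak B(\mathsf H)$ and $q\in\mathbb H$ put $\Delta_q(T):=T^2-T(q+\overline q)+\mathrm I|q|^2$. The spherical resolvent set $\rho_S(T)$ is the set of $q\in\mathbb H$ such that $\mathrm{Ker}(\Delta_q(T))=\{0\}$,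 $\mathrm{Ran}(\Delta_q(T))$ is dense in $\mathsf H$, and $\Delta_q(T)^{-1}:\mathrm{Ran}(\Delta_q(T))\to\mathsf H$ is bounded. The spherical spectrum is $\sigma_S(T):=\mathbb H\setminus\rho_S(T)$ and the spherical spectral radius is $r_S(T):=\sup\{|q| : q\in\sigma_S(T)\}\in[0,+\infty]$. Theorem. Let $\mathsf H$ be a quaternionic Hilbert space and let $T\in\mathfrak B(\mathsf H)$. Then: (a) Let $q\in\mathbb H$ with $|q|>\|T\|$ and, for $n\in\mathbb N=\{0,1,2,\dots\}$, put $a_n:=|q|^{-2n-2}\sum_{h=0}^n q^h\,\overline q^{\,n-h}$. Then every $a_n$ is real, $\Delta_q(T)$ is invertible in $\mathfrak B(\mathsf H)$, and the series $\sum_{n\in\mathbb N}T^na_n$ converges absolutely in $\mathfrak B(\mathsf H)$ with respect to the operator norm to $\Delta_q(T)^{-1}$. In particular, $r_S(T)\le\|T\|$. (b) $\sigma_S(T)$ is a nonempty compact subset of $\mathbb H$. (c) If $T$ is self-adjoint, then for every real polynomial $P(X)=\sum_{h=0}^d X^hr_h\in\mathbb R[X]$, with $P(T):=\sum_{h=0}^d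 T^hr_h$, one has $\sigma_S(P(T))=P(\sigma_S(T)):=\{P(q) : q\in\sigma_S(T)\}$. (d) For every $n\in\mathbb N$, $\sigma_S(T^n)=\sigma_S(T)^n:=\{q^n : q\in\sigma_S(T)\}$. (e) $r_S(T)=\lim_{n\to+\infty}\|T^n\|^{1/n}$. In particular, if $T$ is normal, then $r_S(T)=\|T\|$. -/

import Mathlib

open scoped Quaternion Topology ENNReal

noncomputable section

open scoped RightActions in
/-- A Hermitean quaternionic scalar product on a right `ℍ`-module `H` whose norm is
`‖u‖ = √⟨u|u⟩`, i.e. a quaternionic pre-Hilbert space.  Right `ℍ`-modules are modules over `ℍᵐᵒᵖ`,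
and `u <• q` is the right scalar multiple `u q`.  The last axiom says that `⟨u|u⟩` is the real
number `‖u‖ ^ 2`, so it contains the positivity of the scalar product.
A quaternionic Hilbert space is such a space which is complete and nonzero. -/
class QuaternionicInnerProductSpace (H : Type*) [NormedAddCommGroup H]
    extends Module ℍᵐᵒᵖ H, Inner ℍ H where
  inner_right_linear : ∀ (u v w : H) (p q : ℍ),
    inner u (v <• p + w <• q) = inner u v * p + inner u w * q
  inner_hermitian : ∀ u v : H, inner u v = star (inner v u)
  inner_self : ∀ u : H, inner u u = ((‖u‖ ^ 2 : ℝ) : ℍ)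

namespace QuaternionicHilbert

section Basic

variable {H : Type*} [NormedAddCommGroup H] [QuaternionicInnerProductSpace H]

open QuaternionicInnerProductSpace
open scoped RightActions

theorem inner_add_right (u v w : H) : inner ℍ u (v + w) = inner ℍ u v + inner ℍ u w := by
  simpa using inner_right_linear u v w 1 1

theorem inner_smul_right (u v : H) (q : ℍ) : inner ℍ u (v <• q) = inner ℍ u v * q := by
  simpa using inner_right_linear u v v q 0

theorem inner_add_left (u v w : H) : inner ℍ (u + v) w = inner ℍ u w + inner ℍ v w := by
  rw [inner_hermitian, inner_add_right, star_add, ← inner_hermitian, ← inner_hermitian]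

theorem inner_smul_left (u v : H) (q : ℍ) : inner ℍ (u <• q) v = star q * inner ℍ u v := by
  rw [inner_hermitian, inner_smul_right, star_mul, ← inner_hermitian]

/-- The underlying real vector space: `r • u = u r` for `r : ℝ`. -/
abbrev moduleReal : Module ℝ H := Module.compHom H (algebraMap ℝ ℍᵐᵒᵖ)

theorem norm_sq_eq (u : H) : ‖u‖ ^ 2 = (inner ℍ u u).re := by
  rw [QuaternionicInnerProductSpace.inner_self u, Quaternion.re_coe]

/-- The underlying real inner product space, with scalar product `Re ⟨u|v⟩`. -/
instance instInnerProductSpaceReal : InnerProductSpace ℝ H :=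
  { (moduleReal : Module ℝ H) with
    norm_smul_le := fun r u => by
      refine le_of_eq ((sq_eq_sq₀ (norm_nonneg _) (by positivity)).1 ?_)
      change ‖u <• (r : ℍ)‖ ^ 2 = _
      rw [norm_sq_eq, inner_smul_left, inner_smul_right,
        QuaternionicInnerProductSpace.inner_self u, mul_pow, Real.norm_eq_abs, sq_abs]
      simp only [Quaternion.star_coe, ← Quaternion.coe_mul, Quaternion.re_coe]
      ring
    inner := fun u v => (inner ℍ u v).re
    norm_sq_eq_re_inner := norm_sq_eq
    conj_inner_symm := fun u v => by
      change (inner ℍ v u).re = (inner ℍ u v).re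
      rw [inner_hermitian v u, Quaternion.re_star]
    add_left := fun u v w => by
      change (inner ℍ (u + v) w).re = (inner ℍ u w).re + (inner ℍ v w).re
      rw [inner_add_left, Quaternion.re_add]
    smul_left := fun u v r => by
      change (inner ℍ (u <• (r : ℍ)) v).re = r * (inner ℍ u v).re
      rw [inner_smul_left, Quaternion.star_coe, Quaternion.coe_mul_eq_smul, Quaternion.re_smul,
        smul_eq_mul] }

theorem real_smul_def (r : ℝ) (u : H) : r • u = u <• (r : ℍ) := rfl

theorem real_inner_def (u v : H) : inner ℝ u v = (inner ℍ u v).re := rfl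

instance instIsScalarTower : IsScalarTower ℝ ℍᵐᵒᵖ H where
  smul_assoc r q u := by
    change (r • q) • u = (algebraMap ℝ ℍᵐᵒᵖ r) • (q • u)
    rw [smul_smul, Algebra.smul_def]

instance instSMulCommClass : SMulCommClass ℍᵐᵒᵖ ℝ H where
  smul_comm q r u := by
    change q • (algebraMap ℝ ℍᵐᵒᵖ r) • u = (algebraMap ℝ ℍᵐᵒᵖ r) • (q • u)
    rw [smul_smul, smul_smul, Algebra.commutes]

end Basic

/-- `𝔅(H)`: the everywhere defined bounded (equivalently, continuous) right `ℍ`-linear operators. -/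
abbrev BoundedOperator (H : Type*) [NormedAddCommGroup H] [QuaternionicInnerProductSpace H] :=
  H →L[ℍᵐᵒᵖ] H

section Operators

open scoped RightActions

variable {H : Type*} [NormedAddCommGroup H] [QuaternionicInnerProductSpace H]

/-- The real algebra structure of `𝔅(H)`: the product is the composition, `(r • T) u = (T u) r`. -/
instance instAlgebraReal : Algebra ℝ (BoundedOperator H) :=
  Algebra.ofModule (fun r S T => by ext u; rfl)
    (fun r S T => by
      ext u
      change S (r • T u) = r • S (T u)
      exact S.map_smul_of_tower r (T u))

/-- Forgetting the quaternionic linearity. -/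
def toReal : BoundedOperator H →ₐ[ℝ] (H →L[ℝ] H) where
  toFun T := T.restrictScalars ℝ
  map_one' := rfl
  map_mul' _ _ := rfl
  map_zero' := rfl
  map_add' _ _ := rfl
  commutes' _ := rfl

theorem toReal_injective : Function.Injective (toReal (H := H)) := fun S T h => by
  ext u
  exact congrArg (fun A : H →L[ℝ] H => A u) h

/-- The operator norm of `𝔅(H)`. It depends only on the underlying map. -/
instance instNormedRing : NormedRing (BoundedOperator H) :=
  NormedRing.induced (BoundedOperator H) (H →L[ℝ] H) toReal toReal_injective

theorem norm_def (T : BoundedOperator H) :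
    ‖T‖ = sInf {K : ℝ | 0 ≤ K ∧ ∀ u : H, ‖T u‖ ≤ K * ‖u‖} := rfl

/-- The underlying map of the adjoint: the adjoint for `Re ⟨u|v⟩`, which is right `ℍ`-linear. -/
def adjoint [CompleteSpace H] (T : BoundedOperator H) : BoundedOperator H where
  toFun := ContinuousLinearMap.adjoint (toReal T)
  map_add' := map_add _
  map_smul' q u := by
    have key (x y : H) : (inner ℍ (ContinuousLinearMap.adjoint (toReal T) x) y).re =
        (inner ℍ x (T y)).re := ContinuousLinearMap.adjoint_inner_left (toReal T) y x
    have hcomm (a b : ℍ) : (a * b).re = (b * a).re := by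
      simp only [Quaternion.re_mul]; ring
    refine ext_inner_right ℝ fun v => ?_
    obtain ⟨q, rfl⟩ := MulOpposite.op_surjective q
    simp only [real_inner_def, RingHom.id_apply]
    rw [key, inner_smul_left, hcomm, ← inner_smul_right, inner_smul_left, hcomm,
      ← inner_smul_right, key]
    congr 2
    exact (T.map_smul _ _).symm
  cont := (ContinuousLinearMap.adjoint (toReal T)).continuous

/-- `T ↦ T*`; with it `IsSelfAdjoint T` is `T* = T` and `IsStarNormal T` is `T* T = T T*`. -/
instance instStar [CompleteSpace H] : Star (BoundedOperator H) := ⟨adjoint⟩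

/-- The defining property of the adjoint: `⟨T* u | v⟩ = ⟨u | T v⟩`. -/
theorem inner_star_left [CompleteSpace H] (T : BoundedOperator H) (u v : H) :
    inner ℍ (star T u) v = inner ℍ u (T v) := by
  have key (y : H) : (inner ℍ (star T u) y).re = (inner ℍ u (T y)).re :=
    ContinuousLinearMap.adjoint_inner_left (toReal T) y u
  have h (q : ℍ) : ((inner ℍ (star T u) v - inner ℍ u (T v)) * q).re = 0 := by
    have := key (v <• q)
    rw [T.map_smul, inner_smul_right, inner_smul_right] at this
    rw [sub_mul, Quaternion.re_sub, this, sub_self]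
  have h2 := h (star (inner ℍ (star T u) v - inner ℍ u (T v)))
  rw [Quaternion.self_mul_star, Quaternion.re_coe, Quaternion.normSq_eq_zero] at h2
  exact sub_eq_zero.1 h2

/-- `Δ_q(T) = T² - T (q + q̄) + I |q|²`, where `q + q̄ = 2 Re q`. -/
def Delta (q : ℍ) (T : BoundedOperator H) : BoundedOperator H :=
  T ^ 2 - (2 * q.re) • T + (‖q‖ ^ 2) • (1 : BoundedOperator H)

theorem Delta_apply (q : ℍ) (T : BoundedOperator H) (u : H) :
    Delta q T u = T (T u) - T u <• (q + star q) + u <• ((‖q‖ ^ 2 : ℝ) : ℍ) := by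
  rw [Quaternion.self_add_star]
  change T (T u) - (2 * q.re) • T u + (‖q‖ ^ 2) • u = _
  rw [real_smul_def, real_smul_def, Quaternion.coe_mul]
  rfl

/-- The spherical resolvent set of `T`: `Δ_q(T)` has trivial kernel, dense range, and its inverse
`Ran Δ_q(T) → H` is bounded. -/
def sphericalResolventSet (T : BoundedOperator H) : Set ℍ :=
  {q | (∀ u : H, Delta q T u = 0 → u = 0) ∧ Dense (Set.range (Delta q T)) ∧
    ∃ K : ℝ, ∀ u : H, ‖u‖ ≤ K * ‖Delta q T u‖}

/-- The spherical spectrum `σ_S(T)`. -/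
def sphericalSpectrum (T : BoundedOperator H) : Set ℍ := (sphericalResolventSet T)ᶜ

/-- The spherical spectral radius `r_S(T) = sup {|q| : q ∈ σ_S(T)}`, in `[0, +∞]`. -/
def sphericalSpectralRadius (T : BoundedOperator H) : ℝ≥0∞ :=
  ⨆ q ∈ sphericalSpectrum T, ENNReal.ofReal ‖q‖

end Operators

end QuaternionicHilbert

end

open QuaternionicHilbert

/-!
Restricting scalars from `ℍ` to the slice `ℂ = ℝ + ℝ i` turns `H` into a complex Hilbert space and
`T` into a complex operator with the same norm, powers and adjoint. Every quaternion is `φ z` for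
some real algebra embedding `φ : ℂ → ℍ`, and then `Δ_q(T) = (z - T) (z̄ - T)`. Right multiplication
by `j` is antilinear and commutes with `T`, so it conjugates `z̄ - T` to `z - T`; hence `Δ_q(T)` is
invertible exactly when `z - T` is. Thus `σ_S(T)` is the set of all `φ z` with `z` in the complex
spectrum of `T`, and (b)–(e) follow from the complex spectral theory together with
`P (φ z) = φ (P z)` for real `P`. For (a), `Δ_q(T)⁻¹ = (z - T)⁻¹ (z̄ - T)⁻¹` is the Cauchy product
of two Neumann series.
-/

noncomputable section

namespace QuaternionicHilbert

open Finset.HasAntidiagonal (antidiagonal mem_antidiagonal)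

section Resolvent

theorem map_ringInverse_of_isUnit {M N F : Type*} [MonoidWithZero M] [MonoidWithZero N]
    [FunLike F M N] [MonoidHomClass F M N] (f : F) {x : M} (hx : IsUnit x) :
    f (Ring.inverse x) = Ring.inverse (f x) := by
  obtain ⟨u, rfl⟩ := hx
  rw [Ring.inverse_unit]
  exact (Ring.inverse_unit (Units.map (f : M →* N) u)).symm

theorem commute_algebraMap_sub_algebraMap_sub {R A : Type*} [CommRing R] [Ring A] [Algebra R A]
    (a : A) (z w : R) : Commute (algebraMap R A z - a) (algebraMap R A w - a) :=
  (Algebra.commute_algebraMap_left z _).sub_left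
    ((Algebra.commute_algebraMap_right w a).sub_right (Commute.refl a))

variable {𝕜 A : Type*} [NormedField 𝕜] [NormedRing A] [NormedAlgebra 𝕜 A] {a : A} {z w : 𝕜}

theorem norm_inv_smul_lt_one (h : ‖a‖ < ‖z‖) : ‖z⁻¹ • a‖ < 1 := by
  rw [norm_smul, norm_inv, inv_mul_lt_one₀ ((norm_nonneg a).trans_lt h)]
  exact h

theorem inv_pow_succ_smul_pow (z : 𝕜) (a : A) (n : ℕ) :
    z⁻¹ ^ (n + 1) • a ^ n = z⁻¹ • (z⁻¹ • a) ^ n := by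
  rw [smul_pow, smul_smul, pow_succ']

theorem mem_resolventSet_of_norm_lt [HasSummableGeomSeries A] (h : ‖a‖ < ‖z‖) :
    z ∈ resolventSet 𝕜 a := by
  have hz : z ≠ 0 := norm_pos_iff.1 ((norm_nonneg a).trans_lt h)
  have hfactor : algebraMap 𝕜 A z - a = Units.mk0 z hz • (1 - z⁻¹ • a) := by
    rw [Units.smul_mk0, smul_sub, smul_inv_smul₀ hz, Algebra.algebraMap_eq_smul_one]
  rw [spectrum.mem_resolventSet_iff, hfactor]
  exact (isUnit_one_sub_of_norm_lt_one (norm_inv_smul_lt_one h)).smul _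

theorem hasSum_resolvent [HasSummableGeomSeries A] (h : ‖a‖ < ‖z‖) :
    HasSum (fun n : ℕ => z⁻¹ ^ (n + 1) • a ^ n) (resolvent a z) := by
  have hz : z ≠ 0 := norm_pos_iff.1 ((norm_nonneg a).trans_lt h)
  have hresolvent : resolvent a z = z⁻¹ • Ring.inverse (1 - z⁻¹ • a) := by
    rw [eq_inv_smul_iff₀ hz]
    simpa [resolvent, Units.smul_def] using
      spectrum.units_smul_resolvent_self (r := Units.mk0 z hz) (a := a)
  simp only [hresolvent, inv_pow_succ_smul_pow]
  exact (hasSum_geom_series_inverse _ (norm_inv_smul_lt_one h)).const_smul z⁻¹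

theorem summable_norm_inv_pow_succ_smul_pow (h : ‖a‖ < ‖z‖) :
    Summable fun n : ℕ => ‖z⁻¹ ^ (n + 1) • a ^ n‖ := by
  simp only [inv_pow_succ_smul_pow, norm_smul _ ((_ : A) ^ _)]
  refine Summable.mul_left _ ?_
  have hgeom := summable_geometric_of_lt_one (norm_nonneg _) (norm_inv_smul_lt_one h)
  exact hgeom.of_norm_bounded_eventually_nat <| by
    simpa only [norm_norm] using eventually_norm_pow_le (z⁻¹ • a)

theorem sum_antidiagonal_inv_pow_succ_smul_pow (z w : 𝕜) (a : A) (n : ℕ) :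
    ∑ kl ∈ antidiagonal n, z⁻¹ ^ (kl.1 + 1) • a ^ kl.1 * w⁻¹ ^ (kl.2 + 1) • a ^ kl.2 =
      (∑ kl ∈ antidiagonal n, z⁻¹ ^ (kl.1 + 1) * w⁻¹ ^ (kl.2 + 1)) • a ^ n := by
  rw [Finset.sum_smul]
  refine Finset.sum_congr rfl fun kl hkl => ?_
  rw [smul_mul_smul_comm, ← pow_add, mem_antidiagonal.1 hkl]

theorem summable_norm_sum_antidiagonal_smul_pow (hz : ‖a‖ < ‖z‖) (hw : ‖a‖ < ‖w‖) :
    Summable fun n : ℕ =>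
      ‖(∑ kl ∈ antidiagonal n, z⁻¹ ^ (kl.1 + 1) * w⁻¹ ^ (kl.2 + 1)) • a ^ n‖ := by
  simpa only [sum_antidiagonal_inv_pow_succ_smul_pow] using
    summable_norm_sum_mul_antidiagonal_of_summable_norm
      (summable_norm_inv_pow_succ_smul_pow hz) (summable_norm_inv_pow_succ_smul_pow hw)

theorem hasSum_resolvent_mul_resolvent [CompleteSpace A] (hz : ‖a‖ < ‖z‖) (hw : ‖a‖ < ‖w‖) :
    HasSum (fun n : ℕ =>
        (∑ kl ∈ antidiagonal n, z⁻¹ ^ (kl.1 + 1) * w⁻¹ ^ (kl.2 + 1)) • a ^ n)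
      (resolvent a z * resolvent a w) := by
  have hproduct := tsum_mul_tsum_eq_tsum_sum_antidiagonal_of_summable_norm
    (summable_norm_inv_pow_succ_smul_pow hz) (summable_norm_inv_pow_succ_smul_pow hw)
  simp only [(hasSum_resolvent hz).tsum_eq, (hasSum_resolvent hw).tsum_eq,
    sum_antidiagonal_inv_pow_succ_smul_pow] at hproduct
  exact hproduct ▸ (summable_norm_sum_antidiagonal_smul_pow hz hw).of_norm.hasSum

end Resolvent

section Coefficients

theorem sum_antidiagonal_inv_pow_succ {K : Type*} [Field K] {z w : K} (hz : z ≠ 0) (hw : w ≠ 0)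
    (n : ℕ) :
    ∑ kl ∈ antidiagonal n, z⁻¹ ^ (kl.1 + 1) * w⁻¹ ^ (kl.2 + 1) =
      ((z * w) ^ (n + 1))⁻¹ * ∑ kl ∈ antidiagonal n, z ^ kl.1 * w ^ kl.2 := by
  rw [← Finset.Nat.sum_antidiagonal_swap (f := fun kl => z ^ kl.1 * w ^ kl.2), Finset.mul_sum]
  refine Finset.sum_congr rfl fun kl hkl => ?_
  rw [← mem_antidiagonal.1 hkl, Prod.fst_swap, Prod.snd_swap, inv_pow, inv_pow, mul_pow]
  field_simp
  ring

theorem isSelfAdjoint_sum_antidiagonal_pow_mul_star_pow {R : Type*} [Semiring R] [StarRing R]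
    (q : R) (n : ℕ) :
    IsSelfAdjoint (∑ kl ∈ antidiagonal n, q ^ kl.1 * star q ^ kl.2) := by
  rw [IsSelfAdjoint, star_sum,
    ← Finset.Nat.sum_antidiagonal_swap (f := fun kl => q ^ kl.1 * star q ^ kl.2)]
  simp only [star_mul, star_pow, star_star, Prod.fst_swap, Prod.snd_swap]

end Coefficients

section Slices

open scoped ComplexConjugate

theorem re_eq_zero_of_mul_self_eq_neg_one {q : ℍ} (h : q * q = -1) : q.re = 0 := by
  have hnormSq : Quaternion.normSq q = 1 := by
    rw [← pow_eq_one_iff_of_nonneg Quaternion.normSq_nonneg two_ne_zero, pow_two, ← map_mul, h,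
      Quaternion.normSq_neg, map_one]
  rw [← Quaternion.sq_eq_neg_normSq, hnormSq, pow_two, h, Quaternion.coe_one]

theorem algHom_ofReal (φ : ℂ →ₐ[ℝ] ℍ) (r : ℝ) : φ (r : ℂ) = (r : ℍ) := φ.commutes r

theorem algHom_apply (φ : ℂ →ₐ[ℝ] ℍ) (z : ℂ) : φ z = (z.re : ℍ) + z.im • φ Complex.I := by
  conv_lhs => rw [← Complex.re_add_im z, map_add, algHom_ofReal, ← Complex.real_smul, map_smul]

theorem re_algHom_I (φ : ℂ →ₐ[ℝ] ℍ) : (φ Complex.I).re = 0 :=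
  re_eq_zero_of_mul_self_eq_neg_one (by rw [← map_mul, Complex.I_mul_I, map_neg, map_one])

theorem re_algHom (φ : ℂ →ₐ[ℝ] ℍ) (z : ℂ) : (φ z).re = z.re := by
  rw [algHom_apply, Quaternion.re_add, Quaternion.re_smul, re_algHom_I, smul_zero, add_zero,
    Quaternion.re_coe]

theorem star_algHom (φ : ℂ →ₐ[ℝ] ℍ) (z : ℂ) : star (φ z) = φ (conj z) := by
  rw [algHom_apply, algHom_apply φ (conj z), star_add, Quaternion.star_smul,
    Quaternion.star_eq_neg.2 (re_algHom_I φ), Complex.conj_re, Complex.conj_im,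
    Quaternion.star_coe, neg_smul, smul_neg]

theorem norm_algHom (φ : ℂ →ₐ[ℝ] ℍ) (z : ℂ) : ‖φ z‖ = ‖z‖ := by
  rw [← sq_eq_sq₀ (norm_nonneg _) (norm_nonneg _), ← Quaternion.coe_inj, pow_two,
    ← Quaternion.normSq_eq_norm_mul_self, ← Quaternion.self_mul_star, star_algHom, ← map_mul,
    Complex.mul_conj, Complex.sq_norm, algHom_ofReal]

/-- The coordinate, in the closed upper half plane, of `q` in the slice `ℝ + ℝ (im q)` of `ℍ` that
contains it. Two quaternions are conjugate exactly when they have the same coordinate. -/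
def sliceCoord (q : ℍ) : ℂ := ⟨q.re, ‖q.im‖⟩

theorem continuous_sliceCoord : Continuous sliceCoord := by
  have hcoord : sliceCoord = fun q : ℍ => (q.re : ℂ) + ‖q.im‖ * Complex.I :=
    funext fun q => Complex.mk_eq_add_mul_I _ _
  have hre := Quaternion.continuous_re
  have him := Quaternion.continuous_im
  rw [hcoord]
  fun_prop

theorem inv_norm_smul_mul_self {p : ℍ} (hre : p.re = 0) (hp : p ≠ 0) :
    (‖p‖⁻¹ • p) * (‖p‖⁻¹ • p) = -1 := by
  have hsq : p * p = -((‖p‖ * ‖p‖ : ℝ) : ℍ) := by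
    rw [← Quaternion.normSq_eq_norm_mul_self, ← pow_two]
    exact Quaternion.sq_eq_neg_normSq.2 hre
  have hnorm : ‖p‖ * ‖p‖ ≠ 0 := mul_self_ne_zero.2 (norm_ne_zero_iff.2 hp)
  rw [smul_mul_smul_comm, hsq, smul_neg, ← Quaternion.coe_mul_eq_smul, ← Quaternion.coe_mul,
    ← mul_inv, inv_mul_cancel₀ hnorm, Quaternion.coe_one]

theorem exists_algHom_sliceCoord_eq (q : ℍ) : ∃ φ : ℂ →ₐ[ℝ] ℍ, φ (sliceCoord q) = q := by
  by_cases hq : q.im = 0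
  · refine ⟨Quaternion.ofComplex, ?_⟩
    rw [algHom_apply, sliceCoord, hq, norm_zero, zero_smul, ← hq, Quaternion.re_add_im]
  · refine ⟨Complex.liftAux _ (inv_norm_smul_mul_self (Quaternion.re_im q) hq), ?_⟩
    rw [Complex.liftAux_apply, sliceCoord, smul_inv_smul₀ (norm_ne_zero_iff.2 hq)]
    exact Quaternion.re_add_im q

theorem norm_sliceCoord (q : ℍ) : ‖sliceCoord q‖ = ‖q‖ := by
  obtain ⟨φ, hφ⟩ := exists_algHom_sliceCoord_eq q
  rw [← norm_algHom φ, hφ]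

end Slices

section ComplexStructure

open scoped RightActions ComplexConjugate

variable {H : Type*} [NormedAddCommGroup H] [QuaternionicInnerProductSpace H]

theorem norm_op_smul (u : H) (q : ℍ) : ‖u <• q‖ = ‖u‖ * ‖q‖ := by
  rw [← sq_eq_sq₀ (norm_nonneg _) (by positivity), norm_sq_eq, inner_smul_left, inner_smul_right,
    QuaternionicInnerProductSpace.inner_self u, Quaternion.coe_mul_eq_smul, mul_smul_comm,
    Quaternion.star_mul_self, Quaternion.re_smul, Quaternion.re_coe,
    Quaternion.normSq_eq_norm_mul_self, smul_eq_mul, mul_pow, pow_two ‖q‖]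

/-- The slice `ℂ = ℝ + ℝ i` of `ℍ`, with values in the opposite ring, which acts on the left of a
right `ℍ`-module. -/
def complexToOp : ℂ →+* ℍᵐᵒᵖ :=
  (Quaternion.ofComplex : ℂ →+* ℍ).toOpposite fun z w => (Commute.all z w).map _

/-- The underlying complex vector space: `z • u = u z` for `z` in the slice `ℂ = ℝ + ℝ i`. -/
abbrev moduleComplex : Module ℂ H := Module.compHom H complexToOp

/-- The component in `ℂ` of a quaternion in the decomposition `ℍ = ℂ ⊕ ℂ j`. -/
def complexPart (q : ℍ) : ℂ := ⟨q.re, q.imI⟩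

theorem complexPart_add (p q : ℍ) : complexPart (p + q) = complexPart p + complexPart q := rfl

theorem complexPart_star (q : ℍ) : complexPart (star q) = conj (complexPart q) := by
  apply Complex.ext <;> simp [complexPart]

theorem complexPart_coeComplex_mul (z : ℂ) (q : ℍ) :
    complexPart ((z : ℍ) * q) = z * complexPart q := by
  apply Complex.ext <;> simp [complexPart]

/-- The underlying complex inner product space: its scalar product is the component in `ℂ` of
`⟨u|v⟩`. -/
abbrev innerProductSpaceComplex : InnerProductSpace ℂ H :=
  { (moduleComplex : Module ℂ H) with
    norm_smul_le := fun z u => by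
      change ‖u <• Quaternion.ofComplex z‖ ≤ _
      rw [norm_op_smul, norm_algHom, mul_comm]
    inner := fun u v => complexPart (inner ℍ u v)
    norm_sq_eq_re_inner := norm_sq_eq
    conj_inner_symm := fun u v => by
      rw [← complexPart_star, ← QuaternionicInnerProductSpace.inner_hermitian]
    add_left := fun u v w => by
      rw [inner_add_left, complexPart_add]
    smul_left := fun u v z => by
      change complexPart (inner ℍ (u <• Quaternion.ofComplex z) v) = _
      rw [inner_smul_left, star_algHom, Quaternion.coe_ofComplex, complexPart_coeComplex_mul] }

attribute [local instance] innerProductSpaceComplex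

theorem complex_inner_def (u v : H) : inner ℂ u v = complexPart (inner ℍ u v) := rfl

/-- A bounded quaternionic operator, as an operator of the underlying complex inner product
space. -/
def toComplex : BoundedOperator H →ₐ[ℝ] (H →L[ℂ] H) where
  toFun T :=
    { toFun := T
      map_add' := T.map_add
      map_smul' := fun z u => T.map_smul (complexToOp z) u
      cont := T.continuous }
  map_one' := rfl
  map_mul' _ _ := rfl
  map_zero' := rfl
  map_add' _ _ := rfl
  commutes' r := by
    ext u
    exact congrArg (u <• ·) (Quaternion.coeComplex_coe r).symm

theorem toComplex_apply (T : BoundedOperator H) (u : H) : toComplex T u = T u := rfl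

theorem norm_toComplex (T : BoundedOperator H) : ‖toComplex T‖ = ‖T‖ := rfl

theorem toComplex_real_smul (r : ℝ) (T : BoundedOperator H) :
    toComplex (r • T) = (r : ℂ) • toComplex T :=
  map_smul toComplex r T

theorem isometry_toComplex : Isometry (toComplex (H := H)) :=
  AddMonoidHomClass.isometry_of_norm toComplex norm_toComplex

theorem toComplex_aeval (T : BoundedOperator H) (P : Polynomial ℝ) :
    toComplex (Polynomial.aeval T P) =
      Polynomial.aeval (toComplex T) (P.map (algebraMap ℝ ℂ)) := by
  rw [Polynomial.aeval_map_algebraMap, Polynomial.aeval_algHom_apply]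

theorem toComplex_star [CompleteSpace H] (T : BoundedOperator H) :
    toComplex (star T) = star (toComplex T) := by
  rw [ContinuousLinearMap.star_eq_adjoint, ContinuousLinearMap.eq_adjoint_iff]
  intro u v
  rw [complex_inner_def, complex_inner_def, toComplex_apply, toComplex_apply, inner_star_left]

theorem toComplex_Delta (T : BoundedOperator H) (φ : ℂ →ₐ[ℝ] ℍ) (z : ℂ) :
    toComplex (Delta (φ z) T) =
      (algebraMap ℂ _ z - toComplex T) * (algebraMap ℂ _ (conj z) - toComplex T) := by
  have htrace : ((2 * z.re : ℝ) : ℂ) = z + conj z := (Complex.add_conj z).symm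
  have hnorm : ((‖z‖ ^ 2 : ℝ) : ℂ) = z * conj z := by rw [Complex.mul_conj, Complex.sq_norm]
  rw [Delta, re_algHom, norm_algHom, map_add, map_sub, toComplex_real_smul, toComplex_real_smul,
    htrace, hnorm, map_pow, map_one, Algebra.smul_def, Algebra.smul_def, map_add, map_mul, mul_one,
    sub_mul, mul_sub, mul_sub, ← Algebra.commutes (conj z) (toComplex T)]
  noncomm_ring

/-- The quaternion unit `j`: right multiplication by it is antilinear for the complex structure. -/
@[simps] def unitJ : ℍ := ⟨0, 0, 1, 0⟩

theorem unitJ_mul_coeComplex_conj (z : ℂ) : unitJ * ((conj z : ℂ) : ℍ) = (z : ℍ) * unitJ := by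
  ext <;> simp

theorem bijective_op_smul_unitJ : Function.Bijective fun u : H => u <• unitJ := by
  refine MulAction.bijective₀ (MulOpposite.op_ne_zero_iff _ |>.2 fun h => ?_)
  exact one_ne_zero (congrArg QuaternionAlgebra.imJ h)

theorem sub_toComplex_conj_op_smul_unitJ (T : BoundedOperator H) (z : ℂ) (u : H) :
    (algebraMap ℂ (H →L[ℂ] H) (conj z) - toComplex T) (u <• unitJ) =
      (algebraMap ℂ (H →L[ℂ] H) z - toComplex T) u <• unitJ := by
  have hsub (w : ℂ) (v : H) :
      (algebraMap ℂ (H →L[ℂ] H) w - toComplex T) v = v <• (w : ℍ) - T v := rfl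
  rw [hsub, hsub, T.map_smul, smul_sub, smul_smul, smul_smul, ← MulOpposite.op_mul,
    ← MulOpposite.op_mul, unitJ_mul_coeComplex_conj]

end ComplexStructure

section Invertibility

open scoped RightActions ComplexConjugate

attribute [local instance] innerProductSpaceComplex

variable {H : Type*} [NormedAddCommGroup H] [QuaternionicInnerProductSpace H] [CompleteSpace H]

theorem isUnit_iff_bijective (S : BoundedOperator H) : IsUnit S ↔ Function.Bijective S := by
  constructor
  · rintro ⟨S, rfl⟩
    exact (ContinuousLinearEquiv.ofUnit S).bijective
  · intro h
    let e : H ≃L[ℍᵐᵒᵖ] H :=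
      { LinearEquiv.ofBijective (S : H →ₗ[ℍᵐᵒᵖ] H) h with
        continuous_toFun := S.continuous
        continuous_invFun :=
          (LinearEquiv.ofBijective (S : H →ₗ[ℍᵐᵒᵖ] H) h).toEquiv.continuous_symm_iff.2
            ((toReal S).isOpenMap h.surjective) }
    exact ⟨e.toUnit, rfl⟩

theorem isUnit_toComplex_iff (S : BoundedOperator H) : IsUnit (toComplex S) ↔ IsUnit S := by
  rw [ContinuousLinearMap.isUnit_iff_bijective, isUnit_iff_bijective]
  rfl

theorem mem_sphericalResolventSet_iff (T : BoundedOperator H) (q : ℍ) :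
    q ∈ sphericalResolventSet T ↔ IsUnit (Delta q T) := by
  constructor
  · rintro ⟨-, hdense, K, hK⟩
    have hbound (u : H) : ‖u‖ ≤ K.toNNReal * ‖toReal (Delta q T) u‖ :=
      (hK u).trans (mul_le_mul_of_nonneg_right (Real.le_coe_toNNReal K) (norm_nonneg _))
    rw [isUnit_iff_bijective]
    refine (ContinuousLinearMap.bijective_iff_dense_range_and_antilipschitz
      (toReal (Delta q T))).2 ⟨?_, _, AddMonoidHomClass.antilipschitz_of_bound _ hbound⟩
    exact (Submodule.dense_iff_topologicalClosure_eq_top).1 hdense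
  · intro h
    have hbijective := (isUnit_iff_bijective _).1 h
    obtain ⟨K, hK⟩ := ((ContinuousLinearMap.bijective_iff_dense_range_and_antilipschitz
      (toReal (Delta q T))).1 hbijective).2
    exact ⟨fun u => (map_eq_zero_iff _ hbijective.injective).1, hbijective.surjective.denseRange,
      K, hK.le_mul_norm (map_zero _)⟩

theorem isUnit_sub_toComplex_conj (T : BoundedOperator H) (z : ℂ) :
    IsUnit (algebraMap ℂ (H →L[ℂ] H) (conj z) - toComplex T) ↔
      IsUnit (algebraMap ℂ (H →L[ℂ] H) z - toComplex T) := by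
  have hconj := funext (sub_toComplex_conj_op_smul_unitJ T z)
  rw [ContinuousLinearMap.isUnit_iff_bijective, ContinuousLinearMap.isUnit_iff_bijective,
    ← Function.Bijective.of_comp_iff _ (bijective_op_smul_unitJ (H := H)),
    ← Function.Bijective.of_comp_iff' (bijective_op_smul_unitJ (H := H))
      (algebraMap ℂ (H →L[ℂ] H) z - toComplex T)]
  exact iff_of_eq (congrArg Function.Bijective hconj)

theorem isUnit_Delta_algHom_iff (T : BoundedOperator H) (φ : ℂ →ₐ[ℝ] ℍ) (z : ℂ) :
    IsUnit (Delta (φ z) T) ↔ z ∈ resolventSet ℂ (toComplex T) := by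
  rw [← isUnit_toComplex_iff, toComplex_Delta,
    (commute_algebraMap_sub_algebraMap_sub _ z (conj z)).isUnit_mul_iff, isUnit_sub_toComplex_conj,
    and_self, spectrum.mem_resolventSet_iff]

theorem algHom_mem_sphericalSpectrum_iff (T : BoundedOperator H) (φ : ℂ →ₐ[ℝ] ℍ) (z : ℂ) :
    φ z ∈ sphericalSpectrum T ↔ z ∈ spectrum ℂ (toComplex T) := by
  rw [sphericalSpectrum, spectrum, Set.mem_compl_iff, Set.mem_compl_iff,
    mem_sphericalResolventSet_iff, isUnit_Delta_algHom_iff]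

theorem sphericalSpectrum_eq_preimage_sliceCoord (T : BoundedOperator H) :
    sphericalSpectrum T = sliceCoord ⁻¹' spectrum ℂ (toComplex T) := by
  ext q
  obtain ⟨φ, hφ⟩ := exists_algHom_sliceCoord_eq q
  rw [Set.mem_preimage, ← algHom_mem_sphericalSpectrum_iff T φ, hφ]

end Invertibility

section Spectrum

attribute [local instance] innerProductSpaceComplex

variable {H : Type*} [NormedAddCommGroup H] [QuaternionicInnerProductSpace H] [CompleteSpace H]

theorem norm_le_of_mem_sphericalSpectrum (T : BoundedOperator H) {q : ℍ}
    (hq : q ∈ sphericalSpectrum T) : ‖q‖ ≤ ‖T‖ := by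
  rw [sphericalSpectrum_eq_preimage_sliceCoord] at hq
  rw [← norm_sliceCoord]
  by_contra! h
  exact hq (mem_resolventSet_of_norm_lt h)

theorem isUnit_Delta (T : BoundedOperator H) {q : ℍ} (hq : ‖T‖ < ‖q‖) : IsUnit (Delta q T) :=
  (mem_sphericalResolventSet_iff T q).1
    (not_not.1 fun h => hq.not_ge (norm_le_of_mem_sphericalSpectrum T h))

theorem isClosed_sphericalSpectrum (T : BoundedOperator H) : IsClosed (sphericalSpectrum T) := by
  rw [sphericalSpectrum_eq_preimage_sliceCoord]
  exact (spectrum.isClosed _).preimage continuous_sliceCoord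

theorem isCompact_sphericalSpectrum (T : BoundedOperator H) : IsCompact (sphericalSpectrum T) :=
  Metric.isCompact_of_isClosed_isBounded (isClosed_sphericalSpectrum T)
    (isBounded_iff_forall_norm_le.2 ⟨‖T‖, fun _ => norm_le_of_mem_sphericalSpectrum T⟩)

theorem sphericalSpectralRadius_le (T : BoundedOperator H) :
    sphericalSpectralRadius T ≤ ENNReal.ofReal ‖T‖ :=
  iSup₂_le fun _ hq => ENNReal.ofReal_le_ofReal (norm_le_of_mem_sphericalSpectrum T hq)

theorem sphericalSpectralRadius_eq_spectralRadius (T : BoundedOperator H) :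
    sphericalSpectralRadius T = spectralRadius ℂ (toComplex T) := by
  refine le_antisymm (iSup₂_le fun q hq => ?_) (iSup₂_le fun z hz => ?_)
  · rw [sphericalSpectrum_eq_preimage_sliceCoord] at hq
    rw [← norm_sliceCoord, ofReal_norm]
    exact le_iSup₂_of_le (sliceCoord q) hq le_rfl
  · refine le_iSup₂_of_le (Quaternion.ofComplex z)
      ((algHom_mem_sphericalSpectrum_iff T Quaternion.ofComplex z).2 hz) ?_
    rw [norm_algHom, ofReal_norm]
    rfl

theorem tendsto_norm_pow_sphericalSpectralRadius (T : BoundedOperator H) :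
    Filter.Tendsto (fun n : ℕ => ENNReal.ofReal (‖T ^ n‖ ^ (1 / (n : ℝ)))) Filter.atTop
      (𝓝 (sphericalSpectralRadius T)) := by
  have hgelfand := spectrum.pow_norm_pow_one_div_tendsto_nhds_spectralRadius (toComplex T)
  simpa only [← map_pow, norm_toComplex, ← sphericalSpectralRadius_eq_spectralRadius] using hgelfand

theorem isStarNormal_toComplex {T : BoundedOperator H} (hT : IsStarNormal T) :
    IsStarNormal (toComplex T) where
  star_comm_self := by
    rw [← toComplex_star]
    exact hT.star_comm_self.map toComplex

theorem sphericalSpectralRadius_eq_of_isStarNormal {T : BoundedOperator H} (hT : IsStarNormal T) :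
    sphericalSpectralRadius T = ENNReal.ofReal ‖T‖ := by
  have := isStarNormal_toComplex hT
  let _ : CStarAlgebra (H →L[ℂ] H) := {}
  rw [sphericalSpectralRadius_eq_spectralRadius, IsStarNormal.spectralRadius_eq_nnnorm,
    ← norm_toComplex, ofReal_norm]
  rfl

variable [Nontrivial H]

theorem sphericalSpectrum_nonempty (T : BoundedOperator H) : (sphericalSpectrum T).Nonempty := by
  obtain ⟨z, hz⟩ := spectrum.nonempty (toComplex T)
  exact ⟨_, (algHom_mem_sphericalSpectrum_iff T Quaternion.ofComplex z).2 hz⟩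

theorem spectrum_toComplex_aeval (T : BoundedOperator H) (P : Polynomial ℝ) :
    spectrum ℂ (toComplex (Polynomial.aeval T P)) =
      (fun z : ℂ => Polynomial.aeval z P) '' spectrum ℂ (toComplex T) := by
  rw [toComplex_aeval, spectrum.map_polynomial_aeval]
  simp only [Polynomial.eval_map_algebraMap]

theorem sphericalSpectrum_aeval (T : BoundedOperator H) (P : Polynomial ℝ) :
    sphericalSpectrum (Polynomial.aeval T P) =
      (fun q : ℍ => Polynomial.aeval q P) '' sphericalSpectrum T := by
  ext q
  constructor
  · intro hq
    obtain ⟨φ, hφ⟩ := exists_algHom_sliceCoord_eq q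
    rw [← hφ, algHom_mem_sphericalSpectrum_iff, spectrum_toComplex_aeval] at hq
    obtain ⟨w, hw, hwq⟩ := hq
    refine ⟨φ w, (algHom_mem_sphericalSpectrum_iff T φ w).2 hw, ?_⟩
    rw [← hφ, ← hwq]
    exact Polynomial.aeval_algHom_apply φ w P
  · rintro ⟨p, hp, rfl⟩
    obtain ⟨φ, hφ⟩ := exists_algHom_sliceCoord_eq p
    rw [← hφ, algHom_mem_sphericalSpectrum_iff] at hp
    beta_reduce
    rw [← hφ, Polynomial.aeval_algHom_apply, algHom_mem_sphericalSpectrum_iff,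
      spectrum_toComplex_aeval]
    exact Set.mem_image_of_mem _ hp

theorem sphericalSpectrum_pow (T : BoundedOperator H) (n : ℕ) :
    sphericalSpectrum (T ^ n) = (fun q : ℍ => q ^ n) '' sphericalSpectrum T := by
  simpa only [map_pow, Polynomial.aeval_X] using sphericalSpectrum_aeval T (Polynomial.X ^ n)

end Spectrum

section PowerSeries

open scoped ComplexConjugate

attribute [local instance] innerProductSpaceComplex

/-- The real number `aₙ = |q|⁻²ⁿ⁻² ∑ₕ qʰ q̄ⁿ⁻ʰ`, the coefficient of `Xⁿ` in the expansion of
`(X² - 2 (Re q) X + |q|²)⁻¹`. The sum is real, so taking its real part loses nothing. -/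
def resolventCoeff (q : ℍ) (n : ℕ) : ℝ :=
  (‖q‖ ^ (2 * n + 2))⁻¹ * (∑ h ∈ Finset.range (n + 1), q ^ h * star q ^ (n - h)).re

theorem coe_resolventCoeff (q : ℍ) (n : ℕ) :
    (resolventCoeff q n : ℍ) = (((‖q‖ ^ (2 * n + 2))⁻¹ : ℝ) : ℍ) *
      ∑ h ∈ Finset.range (n + 1), q ^ h * star q ^ (n - h) := by
  have hreal := isSelfAdjoint_sum_antidiagonal_pow_mul_star_pow q n
  rw [Finset.Nat.sum_antidiagonal_eq_sum_range_succ fun k l => q ^ k * star q ^ l] at hreal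
  rw [resolventCoeff, Quaternion.coe_mul, ← Quaternion.star_eq_self.1 hreal.star_eq]

theorem resolventCoeff_algHom (φ : ℂ →ₐ[ℝ] ℍ) {z : ℂ} (hz : z ≠ 0) (n : ℕ) :
    (resolventCoeff (φ z) n : ℂ) =
      ∑ kl ∈ antidiagonal n, z⁻¹ ^ (kl.1 + 1) * (conj z)⁻¹ ^ (kl.2 + 1) := by
  have hnorm : ((‖z‖ ^ (2 * n + 2) : ℝ) : ℂ) = (z * conj z) ^ (n + 1) := by
    rw [Complex.mul_conj, ← Complex.sq_norm, ← mul_add_one, pow_mul, Complex.ofReal_pow]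
  apply φ.toRingHom.injective
  change φ _ = φ _
  rw [algHom_ofReal, coe_resolventCoeff, star_algHom, norm_algHom, ← algHom_ofReal φ,
    Complex.ofReal_inv, hnorm, sum_antidiagonal_inv_pow_succ hz ((map_ne_zero conj).2 hz),
    Finset.Nat.sum_antidiagonal_eq_sum_range_succ fun k l => z ^ k * conj z ^ l]
  simp only [map_mul, map_sum, map_pow]

variable {H : Type*} [NormedAddCommGroup H] [QuaternionicInnerProductSpace H]

theorem toComplex_resolventCoeff_smul_pow (T : BoundedOperator H) (φ : ℂ →ₐ[ℝ] ℍ) {z : ℂ}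
    (hz : z ≠ 0) (n : ℕ) :
    toComplex (resolventCoeff (φ z) n • T ^ n) =
      (∑ kl ∈ antidiagonal n, z⁻¹ ^ (kl.1 + 1) * (conj z)⁻¹ ^ (kl.2 + 1)) • toComplex T ^ n := by
  rw [toComplex_real_smul, resolventCoeff_algHom φ hz, map_pow]

theorem summable_norm_resolventCoeff_smul_pow (T : BoundedOperator H) {q : ℍ} (hq : ‖T‖ < ‖q‖) :
    Summable fun n : ℕ => ‖resolventCoeff q n • T ^ n‖ := by
  obtain ⟨φ, hφ⟩ := exists_algHom_sliceCoord_eq q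
  rw [← norm_sliceCoord, ← norm_toComplex] at hq
  have hz : sliceCoord q ≠ 0 := norm_pos_iff.1 ((norm_nonneg _).trans_lt hq)
  rw [← hφ]
  simp only [← norm_toComplex, toComplex_resolventCoeff_smul_pow T φ hz]
  exact summable_norm_sum_antidiagonal_smul_pow hq (by rwa [Complex.norm_conj])

theorem toComplex_inverse_Delta [CompleteSpace H] (T : BoundedOperator H) (φ : ℂ →ₐ[ℝ] ℍ) {z : ℂ}
    (hz : z ∈ resolventSet ℂ (toComplex T)) :
    toComplex (Ring.inverse (Delta (φ z) T)) =
      resolvent (toComplex T) z * resolvent (toComplex T) (conj z) := by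
  rw [map_ringInverse_of_isUnit toComplex ((isUnit_Delta_algHom_iff T φ z).2 hz), toComplex_Delta,
    (commute_algebraMap_sub_algebraMap_sub _ z (conj z)).eq, Ring.inverse_mul (Or.inr hz)]
  rfl

theorem hasSum_resolventCoeff_smul_pow [CompleteSpace H] (T : BoundedOperator H) {q : ℍ}
    (hq : ‖T‖ < ‖q‖) :
    HasSum (fun n : ℕ => resolventCoeff q n • T ^ n) (Ring.inverse (Delta q T)) := by
  obtain ⟨φ, hφ⟩ := exists_algHom_sliceCoord_eq q
  rw [← norm_sliceCoord, ← norm_toComplex] at hq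
  have hz : sliceCoord q ≠ 0 := norm_pos_iff.1 ((norm_nonneg _).trans_lt hq)
  have hconj : ‖toComplex T‖ < ‖conj (sliceCoord q)‖ := by rwa [Complex.norm_conj]
  rw [← hφ, ← isometry_toComplex.isUniformInducing.isInducing.hasSum_iff,
    toComplex_inverse_Delta T φ (mem_resolventSet_of_norm_lt hq)]
  simp only [Function.comp_def, toComplex_resolventCoeff_smul_pow T φ hz]
  exact hasSum_resolvent_mul_resolvent hq hconj

end PowerSeries

end QuaternionicHilbert

end

theorem mainTheorem8_general {H : Type*} [NormedAddCommGroup H] [QuaternionicInnerProductSpace H]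
    [CompleteSpace H] [Nontrivial H] (T : BoundedOperator H) :
    (∀ q : ℍ, ‖T‖ < ‖q‖ →
      ∃ a : ℕ → ℝ,
        (∀ n : ℕ, (a n : ℍ) = (((‖q‖ ^ (2 * n + 2))⁻¹ : ℝ) : ℍ) *
          ∑ h ∈ Finset.range (n + 1), q ^ h * star q ^ (n - h)) ∧
        Summable (fun n : ℕ => ‖a n • T ^ n‖) ∧
        IsUnit (Delta q T) ∧
        HasSum (fun n : ℕ => a n • T ^ n) (Ring.inverse (Delta q T))) ∧
    sphericalSpectralRadius T ≤ ENNReal.ofReal ‖T‖ ∧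
    (sphericalSpectrum T).Nonempty ∧ IsCompact (sphericalSpectrum T) ∧
    (∀ P : Polynomial ℝ,
      sphericalSpectrum (Polynomial.aeval T P) =
        (fun q : ℍ => Polynomial.aeval q P) '' sphericalSpectrum T) ∧
    (∀ n : ℕ, sphericalSpectrum (T ^ n) = (fun q : ℍ => q ^ n) '' sphericalSpectrum T) ∧
    Filter.Tendsto (fun n : ℕ => ENNReal.ofReal (‖T ^ n‖ ^ (1 / (n : ℝ)))) Filter.atTop
      (𝓝 (sphericalSpectralRadius T)) ∧
    (IsStarNormal T → sphericalSpectralRadius T = ENNReal.ofReal ‖T‖) :=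
  ⟨fun q hq => ⟨resolventCoeff q, coe_resolventCoeff q, summable_norm_resolventCoeff_smul_pow T hq,
      isUnit_Delta T hq, hasSum_resolventCoeff_smul_pow T hq⟩,
    sphericalSpectralRadius_le T, sphericalSpectrum_nonempty T, isCompact_sphericalSpectrum T,
    sphericalSpectrum_aeval T, sphericalSpectrum_pow T,
    tendsto_norm_pow_sphericalSpectralRadius T, sphericalSpectralRadius_eq_of_isStarNormal⟩

theorem mainTheorem8 {H : Type*} [NormedAddCommGroup H] [QuaternionicInnerProductSpace H]
    [CompleteSpace H] [Nontrivial H] (T : BoundedOperator H) :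
    -- (a) power series of the inverse of `Δ_q(T)` for `|q| > ‖T‖`
    (∀ q : ℍ, ‖T‖ < ‖q‖ →
      ∃ a : ℕ → ℝ,
        (∀ n : ℕ, (a n : ℍ) = (((‖q‖ ^ (2 * n + 2))⁻¹ : ℝ) : ℍ) *
          ∑ h ∈ Finset.range (n + 1), q ^ h * star q ^ (n - h)) ∧
        Summable (fun n : ℕ => ‖a n • T ^ n‖) ∧
        IsUnit (Delta q T) ∧
        HasSum (fun n : ℕ => a n • T ^ n) (Ring.inverse (Delta q T))) ∧
    sphericalSpectralRadius T ≤ ENNReal.ofReal ‖T‖ ∧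
    -- (b)
    (sphericalSpectrum T).Nonempty ∧ IsCompact (sphericalSpectrum T) ∧
    -- (c)
    (IsSelfAdjoint T → ∀ P : Polynomial ℝ,
      sphericalSpectrum (Polynomial.aeval T P) =
        (fun q : ℍ => Polynomial.aeval q P) '' sphericalSpectrum T) ∧
    -- (d)
    (∀ n : ℕ, sphericalSpectrum (T ^ n) = (fun q : ℍ => q ^ n) '' sphericalSpectrum T) ∧
    -- (e)
    Filter.Tendsto (fun n : ℕ => ENNReal.ofReal (‖T ^ n‖ ^ (1 / (n : ℝ)))) Filter.atTop
      (𝓝 (sphericalSpectralRadius T)) ∧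
    (IsStarNormal T → sphericalSpectralRadius T = ENNReal.ofReal ‖T‖) :=
  let ⟨ha, hr, hne, hK, hc, hde⟩ := mainTheorem8_general T
  ⟨ha, hr, hne, hK, fun _ => hc, hde⟩
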